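/- For $A\subseteq\mathbb{R}$ let $\lfloor A\rfloor=\{\lfloor a\rfloor : a\in A\}$. For $\alpha\ge 0$, the $\alpha$-mass measure of $A$ is $$\mu^{\alpha}(A)=\limsup_{\ell\to\infty}\frac{\bigl|\lfloor A\rfloor\cap[-\ell,\ell)\bigr|}{(2\ell)^{\alpha}}\in[0,\infty],$$ and the (upper) mass dimension of $A$ is $$\dim_{M}(A)=\inf\{\alpha\ge 0 : \mu^{\alpha}(A)=0\}.$$ Let $f_1,\dots,f_d\in\mathbb{R}[x]$ be non-constant polynomials. For $\lambda\in\mathbb{R}^d$ let $$S_\lambda=\lambda_1 f_1(\mathbb{Z})+\cdots+\lambda_d f_d(\mathbb{Z})=\Bigl\{\sum_{i=1}^d\lambda_i f_i(n_i) : n_1,\dots,n_d\in\mathbb{Z}\Bigr\}.$$ Then for Lebesgue-almost every $\lambda\in\mathbb{R}^d$, $$\dim_{M}(S_\lambda)=\min\Bigl(1,\ \frac1{\deg f_1}+\cdots+\frac1{\deg f_d}\Bigr).$$ Moreover, if $\sum_{i=1}^d\frac1{\deg f_i}\neq 1$, then for Lebesgue-almost every $\lambda\in\mathbb{R}^d$,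 $$\mu^{\min\left(1,\ \sum_{i}1/\deg f_i\right)}(S_\lambda)>0.$$ -/

import Mathlib

open MeasureTheory Filter Set
open scoped Pointwise ENNReal

noncomputable section

/-- `⌊A⌋`: the set of elements of `A ⊆ ℝ` rounded down to integers (as a subset of `ℝ`). -/
def floorSet (A : Set ℝ) : Set ℝ := (fun a : ℝ => (⌊a⌋ : ℝ)) '' A

/-- The `α`-mass measure of `A ⊆ ℝ`, with values in `[0, ∞]`:
`limsup_{ℓ → ∞} |⌊A⌋ ∩ [-ℓ, ℓ)| / (2ℓ)^α`, over real `ℓ`. -/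
def massMeasure (α : ℝ) (A : Set ℝ) : ℝ≥0∞ :=
  limsup (fun ℓ : ℝ =>
    ((floorSet A ∩ Ico (-ℓ) ℓ).encard : ℝ≥0∞) / ENNReal.ofReal ((2 * ℓ) ^ α)) atTop

/-- The (upper) mass dimension of `A ⊆ ℝ`. The infimum is over a set of nonnegative reals which
contains every `α > 1`. -/
def massDim (A : Set ℝ) : ℝ := sInf {α : ℝ | 0 ≤ α ∧ massMeasure α A = 0}

/-- `f(ℤ)`, the image of the integers under a real polynomial. -/
def polyImage (f : Polynomial ℝ) : Set ℝ := range fun n : ℤ => f.eval (n : ℝ)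

end

/-! Write `Φ(n) = (f_i(n_i))_i`, so that `S_c` is the set of values `c · Φ(n)`, and put `σ = ∑ 1/deg
f_i`. Two facts drive both bounds. First, any sup-norm ball of radius `T ≥ 1` contains `Φ(n)` for at
most `O(T^σ)` indices `n`, uniformly in the centre (`exists_card_polyPoint_le`). Second, for `c` in
a fixed cube the slab `|c · v| ≤ t` has measure `O(t / (t + ‖v‖))` (`exists_cubeMeasure_slab_le`).

Upper bound (first moment): if `σ < 1`, summing slab measures over `v = Φ(n)` shows that the mean
number of `n` with `|c · Φ(n)| ≤ t` is `O(t^σ)`. Summing over dyadic `t` with weight `t^(-β)`, `β >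
σ`, gives almost sure finiteness of the `β`-mass. If `σ ≥ 1`, the bound by 1 holds for every set of
reals.

Lower bound (second moment): let `S` be the set of `n` with `‖Φ(n)‖ ≤ T`. By Cauchy-Schwarz the
number of distinct floors of `c · Φ(n)`, `n ∈ S`, is at least `|S|²` divided by the number of pairs
at distance at most 1. The mean of that pair count is `O(|S| T^max(0, σ - 1))` when `σ ≠ 1`, and
`|S| ≫ T^σ`. Fatou's lemma then gives, for almost every `c`, infinitely many scales carrying `≫
T^min(1, σ)` floors. At `σ = 1` the dyadic sum would lose a logarithm, so the counting exponent is
raised to some `s > 1` and then `s` tends to 1, which still determines the dimension. -/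

/-! ### Counting integer points in polynomial sublevel sets -/

open Polynomial in
/-- Integers at which a polynomial of positive degree is within `T` of `a`: their number is at most
a constant times `T ^ (1 / deg)`, uniformly in `a`. -/
theorem exists_card_sublevel_le (f : Polynomial ℝ) (hf : 0 < f.natDegree) :
    ∃ C : ℝ, 0 < C ∧ ∀ a T : ℝ, 1 ≤ T → ∃ S : Finset ℤ,
      (∀ m : ℤ, m ∈ S ↔ |f.eval (m : ℝ) - a| ≤ T) ∧
        (S.card : ℝ) ≤ C * T ^ (1 / (f.natDegree : ℝ)) := by
  set k := f.natDegree with hk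
  have hf0 : f ≠ 0 := by intro h; simp [hk, h] at hf
  set b := |f.leadingCoeff| with hb
  have hbpos : 0 < b := abs_pos.2 (leadingCoeff_ne_zero.2 hf0)
  -- Each of the at most `k` complex roots of `f - a` accounts for at most `2r + 1` integers, with
  -- `r` as below. Only `k` and the leading coefficient enter, hence the uniformity in `a`.
  refine ⟨k * (2 * (2 / b) ^ (1 / (k : ℝ)) + 1), by positivity, fun a T hT => ?_⟩
  set g : Polynomial ℂ := (f - C a).map (algebraMap ℝ ℂ) with hg
  have hlc : g.leadingCoeff = (f.leadingCoeff : ℂ) := by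
    rw [hg, leadingCoeff_map]
    refine congrArg Complex.ofReal ?_
    exact leadingCoeff_sub_of_degree_lt (lt_of_le_of_lt degree_C_le (natDegree_pos_iff_degree_pos.1 hf))
  have hdeg : g.natDegree = k := by
    rw [hg, natDegree_map, natDegree_sub_C]
  have hroots : g.roots.card = k := by
    rw [← hdeg]; exact (splits_iff_card_roots.1 (IsAlgClosed.splits g))
  have hfac : ∀ m : ℤ, |f.eval (m : ℝ) - a| = b * (g.roots.map fun z => ‖(m : ℂ) - z‖).prod := by
    intro m
    have h1 : g.eval (m : ℂ) = ((f.eval (m : ℝ) - a : ℝ) : ℂ) := by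
      rw [hg, eval_map_algebraMap]
      have := aeval_algebraMap_apply ℂ (m : ℝ) (f - C a)
      simpa using this
    have h2 := (IsAlgClosed.splits g).eval_eq_prod_roots (m : ℂ)
    rw [h1, hlc] at h2
    have h3 := congrArg norm h2
    rw [Complex.norm_real, norm_mul, Complex.norm_real, Real.norm_eq_abs, Real.norm_eq_abs] at h3
    rw [h3]
    congr 1
    have h4 := map_multiset_prod (normHom : ℂ →*₀ ℝ) (g.roots.map fun z => (m : ℂ) - z)
    rw [Multiset.map_map] at h4
    exact h4
  -- If `m` is farther than `r` from every root, then `|f(m) - a| ≥ b * r ^ k = 2T > T`. The factor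
  -- 2 gives strictness, since the product comparison is only `≤`.
  set r : ℝ := (2 * T / b) ^ (1 / (k : ℝ)) with hr
  have hrpos : 0 < r := by positivity
  have hnear : ∀ m : ℤ, |f.eval (m : ℝ) - a| ≤ T → ∃ z ∈ g.roots, ‖(m : ℂ) - z‖ ≤ r := by
    intro m hm
    by_contra! hcon
    rw [hfac] at hm
    have h1 : r ^ k ≤ (g.roots.map fun z => ‖(m : ℂ) - z‖).prod := by
      have := Multiset.prod_map_le_prod_map₀ (s := g.roots) (fun _ => r)
        (fun z => ‖(m : ℂ) - z‖) (fun _ _ => hrpos.le) (fun z hz => (hcon z hz).le)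
      simpa [hroots] using this
    have h2 : r ^ k = 2 * T / b := by
      rw [hr, ← Real.rpow_natCast, ← Real.rpow_mul (by positivity),
        one_div_mul_cancel (by positivity), Real.rpow_one]
    rw [h2, div_le_iff₀ hbpos] at h1
    linarith
  set U : Finset ℤ := g.roots.toFinset.biUnion fun z => Finset.Icc ⌈z.re - r⌉ ⌊z.re + r⌋ with hU
  have hmemU : ∀ m : ℤ, |f.eval (m : ℝ) - a| ≤ T → m ∈ U := by
    intro m hm
    obtain ⟨z, hz, hzr⟩ := hnear m hm
    have h1 : |(m : ℝ) - z.re| ≤ r := by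
      refine le_trans ?_ hzr
      simpa using Complex.abs_re_le_norm ((m : ℂ) - z)
    rw [abs_le] at h1
    refine Finset.mem_biUnion.2 ⟨z, by simpa using hz, Finset.mem_Icc.2 ⟨Int.ceil_le.2 ?_, Int.le_floor.2 ?_⟩⟩ <;> linarith
  classical
  refine ⟨U.filter fun m => |f.eval (m : ℝ) - a| ≤ T, fun m => ?_, ?_⟩
  · simp only [Finset.mem_filter]
    exact ⟨fun h => h.2, fun h => ⟨hmemU m h, h⟩⟩
  have hcard : (U.card : ℝ) ≤ k * (2 * r + 1) := by
    have h1 : (U.card : ℝ) ≤ ∑ z ∈ g.roots.toFinset, (2 * r + 1) := by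
      refine le_trans (Nat.cast_le.2 Finset.card_biUnion_le) ?_
      push_cast
      refine Finset.sum_le_sum fun z _ => ?_
      rw [Int.card_Icc]
      have h2 : ((⌊z.re + r⌋ + 1 - ⌈z.re - r⌉ : ℤ) : ℝ) ≤ 2 * r + 1 := by
        push_cast
        have := Int.floor_le (z.re + r)
        have := Int.le_ceil (z.re - r)
        linarith
      have h3 : (((⌊z.re + r⌋ + 1 - ⌈z.re - r⌉).toNat : ℤ) : ℝ) ≤ 2 * r + 1 := by
        rw [Int.toNat_eq_max]
        push_cast at h2 ⊢
        exact max_le h2 (by positivity)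
      exact_mod_cast h3
    rw [Finset.sum_const, nsmul_eq_mul] at h1
    refine h1.trans ?_
    have : g.roots.toFinset.card ≤ k := hroots ▸ Multiset.toFinset_card_le _
    gcongr
  refine le_trans (Nat.cast_le.2 (Finset.card_filter_le _ _)) (hcard.trans ?_)
  have hr2 : r = (2 / b) ^ (1 / (k : ℝ)) * T ^ (1 / (k : ℝ)) := by
    rw [hr, ← Real.mul_rpow (by positivity) (by positivity)]
    congr 1; ring
  have hT1 : 1 ≤ T ^ (1 / (k : ℝ)) := Real.one_le_rpow hT (by positivity)
  rw [hr2, mul_assoc]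
  refine mul_le_mul_of_nonneg_left ?_ (by positivity)
  nlinarith

/-- Lower bound for the number of integers in a sublevel set of a polynomial. -/
theorem exists_le_card_sublevel (f : Polynomial ℝ) (hf : 0 < f.natDegree) :
    ∃ c : ℝ, 0 < c ∧ ∀ᶠ T : ℝ in atTop, ∀ S : Finset ℤ,
      (∀ m : ℤ, |f.eval (m : ℝ)| ≤ T → m ∈ S) →
        c * T ^ (1 / (f.natDegree : ℝ)) ≤ (S.card : ℝ) := by
  set k := f.natDegree with hk
  -- On naturals `|f(m)| ≤ A (m + 1)^k`, so every `j` with `j + 1 ≤ (T / A)^(1/k)` lies in the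
  -- sublevel set. The factor `1/2` below absorbs the floor.
  set A : ℝ := 1 + ∑ i ∈ Finset.range (k + 1), |f.coeff i| with hA
  have hA0 : 0 ≤ ∑ i ∈ Finset.range (k + 1), |f.coeff i| := Finset.sum_nonneg fun _ _ => abs_nonneg _
  have hApos : 0 < A := by linarith
  have hbd : ∀ m : ℕ, |f.eval (m : ℝ)| ≤ A * ((m : ℝ) + 1) ^ k := by
    intro m
    rw [Polynomial.eval_eq_sum_range]
    refine (Finset.abs_sum_le_sum_abs _ _).trans ?_
    have h1 : ∀ i ∈ Finset.range (k + 1), |f.coeff i * (m : ℝ) ^ i| ≤ |f.coeff i| * ((m : ℝ) + 1) ^ k := by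
      intro i hi
      rw [abs_mul, abs_of_nonneg (by positivity : (0 : ℝ) ≤ (m : ℝ) ^ i)]
      refine mul_le_mul_of_nonneg_left ?_ (abs_nonneg _)
      calc (m : ℝ) ^ i ≤ ((m : ℝ) + 1) ^ i := by gcongr; linarith
        _ ≤ ((m : ℝ) + 1) ^ k := pow_le_pow_right₀ (by linarith [(Nat.cast_nonneg m : (0 : ℝ) ≤ m)])
            (Nat.lt_succ_iff.1 (Finset.mem_range.1 hi))
    refine (Finset.sum_le_sum h1).trans ?_
    rw [← Finset.sum_mul]
    gcongr
    linarith
  refine ⟨1 / 2 * (1 / A) ^ (1 / (k : ℝ)), by positivity, ?_⟩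
  filter_upwards [eventually_ge_atTop A] with T hT S hS
  set x : ℝ := (T / A) ^ (1 / (k : ℝ)) with hx
  have hTpos : 0 < T := hApos.trans_le hT
  have hx1 : 1 ≤ x := Real.one_le_rpow ((one_le_div hApos).2 hT) (by positivity)
  have hxk : x ^ k = T / A := by
    rw [hx, ← Real.rpow_natCast, ← Real.rpow_mul (by positivity),
      one_div_mul_cancel (by positivity), Real.rpow_one]
  have hx2 : (1 / A) ^ (1 / (k : ℝ)) * T ^ (1 / (k : ℝ)) = x := by
    rw [hx, ← Real.mul_rpow (by positivity) (by positivity)]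
    congr 1; ring
  rw [mul_assoc, hx2]
  have hsub : (Finset.range ⌊x⌋₊).image (fun m : ℕ => (m : ℤ)) ⊆ S := by
    intro m hm
    obtain ⟨j, hj, rfl⟩ := Finset.mem_image.1 hm
    apply hS
    have h1 : (j : ℝ) + 1 ≤ x := by
      have := Finset.mem_range.1 hj
      have h2 : j + 1 ≤ ⌊x⌋₊ := this
      have h3 := (Nat.le_floor_iff (by linarith)).1 h2
      exact_mod_cast h3
    have h2 : ((j : ℝ) + 1) ^ k ≤ T / A := by
      rw [← hxk]; gcongr
    have h3 := hbd j
    have h4 : A * ((j : ℝ) + 1) ^ k ≤ T := by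
      rwa [le_div_iff₀ hApos, mul_comm] at h2
    simpa using h3.trans h4
  have hc := Finset.card_le_card hsub
  rw [Finset.card_image_of_injective _ Nat.cast_injective, Finset.card_range] at hc
  have h5 : x < ⌊x⌋₊ + 1 := Nat.lt_floor_add_one x
  have h6 : (1 : ℝ) ≤ ⌊x⌋₊ := by
    exact_mod_cast (Nat.le_floor (by simpa using hx1) : 1 ≤ ⌊x⌋₊)
  have h7 : (⌊x⌋₊ : ℝ) ≤ S.card := by exact_mod_cast hc
  linarith

/-- The point of `ℝ^d` with coordinates `f_i(n_i)`. -/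
def polyPoint {d : ℕ} (f : Fin d → Polynomial ℝ) (n : Fin d → ℤ) : Fin d → ℝ :=
  fun i => (f i).eval (n i : ℝ)

theorem prod_mul_rpow {d : ℕ} (C e : Fin d → ℝ) {T : ℝ} (hT : 0 < T) :
    ∏ i, C i * T ^ e i = (∏ i, C i) * T ^ ∑ i, e i := by
  rw [Finset.prod_mul_distrib, Real.rpow_sum_of_pos hT]

theorem exists_card_polyPoint_le {d : ℕ} (f : Fin d → Polynomial ℝ)
    (hf : ∀ i, 0 < (f i).natDegree) :
    ∃ C : ℝ, 0 < C ∧ ∀ (a : Fin d → ℝ) (T : ℝ), 1 ≤ T → ∃ S : Finset (Fin d → ℤ),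
      (∀ n, n ∈ S ↔ ‖polyPoint f n - a‖ ≤ T) ∧
        (S.card : ℝ) ≤ C * T ^ ∑ i, 1 / ((f i).natDegree : ℝ) := by
  choose C hC h using fun i => exists_card_sublevel_le (f i) (hf i)
  refine ⟨∏ i, C i, Finset.prod_pos fun i _ => hC i, fun a T hT => ?_⟩
  choose S hS hcard using fun i => h i (a i) T hT
  refine ⟨Fintype.piFinset S, fun n => ?_, ?_⟩
  · rw [Fintype.mem_piFinset, pi_norm_le_iff_of_nonneg (by linarith)]
    exact forall_congr' fun i => hS i (n i)
  · rw [Fintype.card_piFinset, ← prod_mul_rpow _ _ (by linarith)]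
    push_cast
    exact Finset.prod_le_prod (fun _ _ => by positivity) fun i _ => hcard i

theorem exists_le_card_polyPoint {d : ℕ} (f : Fin d → Polynomial ℝ)
    (hf : ∀ i, 0 < (f i).natDegree) :
    ∃ c : ℝ, 0 < c ∧ ∀ᶠ T : ℝ in atTop, ∀ S : Finset (Fin d → ℤ),
      (∀ n, ‖polyPoint f n‖ ≤ T → n ∈ S) →
        c * T ^ (∑ i, 1 / ((f i).natDegree : ℝ)) ≤ (S.card : ℝ) := by
  choose C hC h using fun i => exists_card_sublevel_le (f i) (hf i)
  choose c hc hlow using fun i => exists_le_card_sublevel (f i) (hf i)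
  refine ⟨∏ i, c i, Finset.prod_pos fun i _ => hc i, ?_⟩
  filter_upwards [eventually_ge_atTop 1, eventually_all.2 hlow] with T hT hT' S hS
  choose U hU _ using fun i => h i 0 T hT
  have hsub : Fintype.piFinset U ⊆ S := by
    intro n hn
    apply hS
    rw [pi_norm_le_iff_of_nonneg (by linarith)]
    intro i
    simpa [polyPoint] using (hU i (n i)).1 (Fintype.mem_piFinset.1 hn i)
  refine le_trans ?_ (Nat.cast_le.2 (Finset.card_le_card hsub))
  rw [Fintype.card_piFinset, ← prod_mul_rpow _ _ (by linarith)]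
  push_cast
  refine Finset.prod_le_prod (fun i _ => mul_nonneg (hc i).le (by positivity)) fun i _ => ?_
  exact hT' i (U i) fun m hm => (hU i m).2 (by simpa using hm)

/-! ### Dyadic summation against a counting function -/

theorem sum_le_tsum_of_card_filter_le {ι : Type*} (F : Finset ι) (y : ι → ℝ) (g : ι → ℝ≥0∞)
    (ρ : ℕ → ℝ) (w v : ℕ → ℝ≥0∞) (hg : ∀ i ∈ F, ∃ k, y i ≤ ρ k ∧ g i ≤ w k)
    (hv : ∀ k, ((F.filter fun i => y i ≤ ρ k).card : ℝ≥0∞) ≤ v k) :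
    ∑ i ∈ F, g i ≤ ∑' k, v k * w k := by
  calc ∑ i ∈ F, g i ≤ ∑ i ∈ F, ∑' k, if y i ≤ ρ k then w k else 0 := by
        refine Finset.sum_le_sum fun i hi => ?_
        obtain ⟨k, hk, hgk⟩ := hg i hi
        refine le_trans ?_ (ENNReal.le_tsum k)
        rwa [if_pos hk]
    _ = ∑' k, ∑ i ∈ F, if y i ≤ ρ k then w k else 0 :=
        (Summable.tsum_finsetSum fun _ _ => ENNReal.summable).symm
    _ ≤ ∑' k, v k * w k := by
        refine ENNReal.tsum_le_tsum fun k => ?_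
        rw [← Finset.sum_filter, Finset.sum_const, nsmul_eq_mul]
        gcongr
        exact hv k

theorem tsum_ofReal_mul_geometric {a r : ℝ} (ha : 0 ≤ a) (hr : 0 ≤ r) (hr1 : r < 1) :
    ∑' k : ℕ, ENNReal.ofReal (a * r ^ k) = ENNReal.ofReal (a * (1 - r)⁻¹) := by
  rw [← ENNReal.ofReal_tsum_of_nonneg (fun k => by positivity)
    ((summable_geometric_of_lt_one hr hr1).mul_left a), tsum_mul_left,
    tsum_geometric_of_lt_one hr hr1]

/-- On the scale `t + y ≈ t 2^k` there are `O((t 2^k)^s)` terms of size `≈ 2^(-k)`. As `s < 1`, the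
series is geometric with ratio `2^(s-1)` and the smallest scale dominates. -/
theorem sum_div_add_le {ι : Type*} {s C t : ℝ} (hs : s < 1) (hC : 0 ≤ C) (ht : 0 < t)
    (F : Finset ι) (y : ι → ℝ) (hy : ∀ i ∈ F, 0 ≤ y i)
    (hcard : ∀ T : ℝ, 0 < T → ((F.filter fun i => y i ≤ T).card : ℝ) ≤ C * T ^ s) :
    ∑ i ∈ F, ENNReal.ofReal (t / (t + y i)) ≤
      ENNReal.ofReal (2 * C * t ^ s * (1 - 2 ^ (s - 1))⁻¹) := by
  have h := sum_le_tsum_of_card_filter_le F y (fun i => ENNReal.ofReal (t / (t + y i)))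
    (fun k => t * 2 ^ k) (fun k => ENNReal.ofReal (2 / 2 ^ k))
    (fun k => ENNReal.ofReal (C * (t * 2 ^ k) ^ s)) ?_ ?_
  · refine h.trans (le_of_eq ?_)
    rw [← tsum_ofReal_mul_geometric (by positivity) (by positivity)
      (Real.rpow_lt_one_of_one_lt_of_neg (by norm_num) (by linarith))]
    refine tsum_congr fun k => ?_
    rw [← ENNReal.ofReal_mul (by positivity)]
    congr 1
    rw [Real.mul_rpow ht.le (by positivity), Real.rpow_sub_one (by norm_num), div_pow,
      ← Real.rpow_natCast_mul (by norm_num), mul_comm (k : ℝ) s, Real.rpow_mul_natCast (by norm_num)]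
    ring
  · intro i hi
    have hyi := hy i hi
    obtain ⟨n, hn, hn'⟩ := exists_nat_pow_near (x := (t + y i) / t) (y := (2 : ℝ))
      ((one_le_div ht).2 (by linarith)) (by norm_num)
    refine ⟨n + 1, ?_, ENNReal.ofReal_le_ofReal ?_⟩
    · rw [div_lt_iff₀ ht] at hn'
      linarith
    · rw [le_div_iff₀ ht] at hn
      rw [pow_succ, div_le_div_iff₀ (by positivity) (by positivity)]
      linarith
  · intro k
    rw [← ENNReal.ofReal_natCast]
    exact ENNReal.ofReal_le_ofReal (hcard _ (by positivity))

/-- For `s > 1` the largest scale dominates instead, so the decomposition descends from `L` through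
`L / 2^k`, with ratio `2^(1-s)`. -/
theorem sum_one_div_le {ι : Type*} {s C L : ℝ} (hs : 1 < s) (hC : 0 ≤ C) (hL : 0 < L)
    (F : Finset ι) (y : ι → ℝ) (hy : ∀ i ∈ F, 0 < y i) (hyL : ∀ i ∈ F, y i ≤ L)
    (hcard : ∀ T : ℝ, 0 < T → ((F.filter fun i => y i ≤ T).card : ℝ) ≤ C * T ^ s) :
    ∑ i ∈ F, ENNReal.ofReal (1 / y i) ≤
      ENNReal.ofReal (2 * C * L ^ (s - 1) * (1 - 2 ^ (1 - s))⁻¹) := by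
  have h := sum_le_tsum_of_card_filter_le F y (fun i => ENNReal.ofReal (1 / y i))
    (fun k => L / 2 ^ k) (fun k => ENNReal.ofReal (2 * 2 ^ k / L))
    (fun k => ENNReal.ofReal (C * (L / 2 ^ k) ^ s)) ?_ ?_
  · refine h.trans (le_of_eq ?_)
    rw [← tsum_ofReal_mul_geometric (by positivity) (by positivity)
      (Real.rpow_lt_one_of_one_lt_of_neg (by norm_num) (by linarith))]
    refine tsum_congr fun k => ?_
    rw [← ENNReal.ofReal_mul (by positivity)]
    congr 1
    rw [Real.div_rpow hL.le (by positivity), Real.rpow_sub_one hL.ne',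
      Real.rpow_sub (by norm_num : (0 : ℝ) < 2), Real.rpow_one, div_pow,
      ← Real.rpow_natCast_mul (by norm_num), mul_comm (k : ℝ) s,
      Real.rpow_mul_natCast (by norm_num)]
    ring
  · intro i hi
    have hyi := hy i hi
    obtain ⟨n, hn, hn'⟩ := exists_nat_pow_near (x := L / y i) (y := (2 : ℝ))
      ((one_le_div hyi).2 (hyL i hi)) (by norm_num)
    refine ⟨n, ?_, ENNReal.ofReal_le_ofReal ?_⟩
    · rw [le_div_iff₀ hyi] at hn
      rw [le_div_iff₀ (by positivity)]
      linarith
    · rw [div_lt_iff₀ hyi, pow_succ] at hn'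
      rw [div_le_div_iff₀ (by positivity) (by positivity)]
      linarith
  · intro k
    rw [← ENNReal.ofReal_natCast]
    exact ENNReal.ofReal_le_ofReal (hcard _ (by positivity))

/-! ### Measure of slabs in a cube -/

/-- Lebesgue measure on the cube `[-R, R]^d`. -/
noncomputable def cubeMeasure (d : ℕ) (R : ℝ) : Measure (Fin d → ℝ) :=
  volume.restrict (Set.pi univ fun _ => Icc (-R) R)

instance (d : ℕ) (R : ℝ) : IsFiniteMeasure (cubeMeasure d R) := by
  refine ⟨?_⟩
  rw [cubeMeasure, Measure.restrict_apply_univ]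
  exact (isCompact_univ_pi fun _ => isCompact_Icc).measure_lt_top

theorem volume_abs_mul_add_le {v : ℝ} (hv : v ≠ 0) (b t : ℝ) :
    volume {x : ℝ | |x * v + b| ≤ t} = ENNReal.ofReal (2 * (t / |v|)) := by
  rw [← Real.volume_closedBall (-b / v)]
  congr 1
  ext x
  rw [Metric.mem_closedBall, Real.dist_eq, mem_ofPred_eq, le_div_iff₀ (abs_pos.2 hv), ← abs_mul]
  congr! 2
  field_simp
  ring

/-- Fubini: with the other coordinates fixed, the slab meets each line in direction `i` in an
interval of length `2t / |v i|`. -/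
theorem cubeMeasure_slab_le_of_ne_zero {n : ℕ} (R t : ℝ) (v : Fin (n + 1) → ℝ) (i : Fin (n + 1))
    (hv : v i ≠ 0) :
    cubeMeasure (n + 1) R {c | |∑ j, c j * v j| ≤ t} ≤
      cubeMeasure n R univ * ENNReal.ofReal (2 * (t / |v i|)) := by
  set Q : Set (Fin n → ℝ) := Set.pi univ fun _ => Icc (-R) R with hQ
  have hQm : MeasurableSet Q := MeasurableSet.univ_pi fun _ => measurableSet_Icc
  set B : Set (ℝ × (Fin n → ℝ)) :=
    {p | p.2 ∈ Q ∧ |p.1 * v i + ∑ j, p.2 j * v (i.succAbove j)| ≤ t} with hB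
  have hBm : MeasurableSet B := by
    have h2 : MeasurableSet {p : ℝ × (Fin n → ℝ) |
        |p.1 * v i + ∑ j, p.2 j * v (i.succAbove j)| ≤ t} := by
      refine measurableSet_le ?_ measurable_const
      fun_prop
    exact (measurable_snd hQm).inter h2
  have hmp := volume_preserving_piFinSuccAbove (fun _ : Fin (n + 1) => ℝ) i
  have hm : MeasurableSet {c : Fin (n + 1) → ℝ | |∑ j, c j * v j| ≤ t} := by
    refine measurableSet_le ?_ measurable_const
    fun_prop
  rw [cubeMeasure, Measure.restrict_apply hm]
  calc _ ≤ volume (MeasurableEquiv.piFinSuccAbove (fun _ : Fin (n + 1) => ℝ) i ⁻¹' B) := by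
        refine measure_mono ?_
        rintro c ⟨hc, hcQ⟩
        refine ⟨fun j _ => hcQ (i.succAbove j) trivial, ?_⟩
        rw [mem_ofPred_eq, Fin.sum_univ_succAbove _ i] at hc
        exact hc
    _ = volume B := hmp.measure_preimage hBm.nullMeasurableSet
    _ = ∫⁻ y, volume ((fun x : ℝ => (x, y)) ⁻¹' B) := by
        rw [Measure.volume_eq_prod, Measure.prod_apply_symm hBm]
    _ ≤ ∫⁻ y, Q.indicator (fun _ => ENNReal.ofReal (2 * (t / |v i|))) y := by
        refine lintegral_mono fun y => ?_
        by_cases hy : y ∈ Q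
        · rw [indicator_of_mem hy, ← volume_abs_mul_add_le hv (∑ j, y j * v (i.succAbove j))]
          exact measure_mono fun x hx => hx.2
        · have : (fun x : ℝ => (x, y)) ⁻¹' B = ∅ := by
            ext x; simp [hB, hy]
          simp [this]
    _ = _ := by
        rw [lintegral_indicator_const hQm, mul_comm, cubeMeasure, Measure.restrict_apply_univ]

/-- The slab `|c · v| ≤ t` occupies a proportion of the cube at most comparable with
`t / (t + ‖v‖)`. -/
theorem exists_cubeMeasure_slab_le (d : ℕ) (R : ℝ) :
    ∃ K : ℝ≥0∞, K ≠ ⊤ ∧ ∀ (v : Fin d → ℝ) (t : ℝ), 0 < t →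
      cubeMeasure d R {c | |∑ j, c j * v j| ≤ t} ≤ K * ENNReal.ofReal (t / (t + ‖v‖)) := by
  -- The first term serves `‖v‖ ≤ t`, where `t / (t + ‖v‖) ≥ 1/2`. The second serves `‖v‖ > t`,
  -- which forces `d ≥ 1`: a coordinate with `|v i| > ‖v‖ / 2` gives `2t / |v i| ≤ 4t / ‖v‖ ≤ 8t /
  -- (t + ‖v‖)`.
  refine ⟨2 * cubeMeasure d R univ + 8 * cubeMeasure (d - 1) R univ, ?_, fun v t ht => ?_⟩
  · finiteness
  have hv0 := norm_nonneg v
  rcases le_or_gt ‖v‖ t with hvt | hvt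
  · calc _ ≤ cubeMeasure d R univ := measure_mono (subset_univ _)
      _ = 2 * cubeMeasure d R univ * ENNReal.ofReal (1 / 2) := by
        rw [mul_comm 2, mul_assoc, ENNReal.ofReal_div_of_pos (by norm_num)]
        simp [ENNReal.mul_inv_cancel]
      _ ≤ _ := by
        refine mul_le_mul' le_self_add (ENNReal.ofReal_le_ofReal ?_)
        · rw [div_le_div_iff₀ (by norm_num) (by positivity)]
          linarith
  · obtain ⟨i, hi⟩ : ∃ i, ‖v‖ / 2 < |v i| := by
      by_contra! hcon
      have := (pi_norm_le_iff_of_nonneg (x := v) (r := ‖v‖ / 2) (by positivity)).2 hcon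
      linarith
    obtain ⟨n, rfl⟩ : ∃ n, d = n + 1 := ⟨d - 1, by have := i.pos; omega⟩
    refine (cubeMeasure_slab_le_of_ne_zero R t v i (abs_pos.1 (by linarith))).trans ?_
    have h8 : ENNReal.ofReal (2 * (t / |v i|)) ≤ 8 * ENNReal.ofReal (t / (t + ‖v‖)) := by
      rw [← ENNReal.ofReal_ofNat, ← ENNReal.ofReal_mul (by norm_num)]
      refine ENNReal.ofReal_le_ofReal ?_
      rw [← mul_div_assoc, ← mul_div_assoc, div_le_div_iff₀ (by linarith) (by positivity)]
      nlinarith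
    calc _ ≤ cubeMeasure n R univ * (8 * ENNReal.ofReal (t / (t + ‖v‖))) := by gcongr
      _ = 8 * cubeMeasure n R univ * ENNReal.ofReal (t / (t + ‖v‖)) := by ring
      _ ≤ _ := by
        gcongr
        exact le_add_self

theorem ae_of_forall_ae_cubeMeasure {d : ℕ} {p : (Fin d → ℝ) → Prop}
    (h : ∀ R : ℕ, ∀ᵐ c ∂cubeMeasure d R, p c) : ∀ᵐ c ∂(volume : Measure (Fin d → ℝ)), p c := by
  have h' : ∀ R : ℕ, ∀ᵐ c ∂(volume : Measure (Fin d → ℝ)),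
      c ∈ Set.pi univ (fun _ => Icc (-(R : ℝ)) R) → p c := fun R =>
    (ae_restrict_iff' (MeasurableSet.univ_pi fun _ => measurableSet_Icc)).1 (h R)
  filter_upwards [ae_all_iff.2 h'] with c hc
  obtain ⟨R, hR⟩ := exists_nat_ge ‖c‖
  exact hc R fun i _ => abs_le.1 ((norm_le_pi_norm c i).trans hR)

/-- Shifting the distance by 1 empties the count for `T < 1`, so the bound holds for all `T > 0`, as
dyadic summation requires. The slack in `s` is used to step off the critical exponent 1. -/
theorem exists_card_one_add_le {d : ℕ} (f : Fin d → Polynomial ℝ)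
    (hf : ∀ i, 0 < (f i).natDegree) {s : ℝ} (hs : ∑ i, 1 / ((f i).natDegree : ℝ) ≤ s) :
    ∃ C : ℝ, 0 < C ∧ ∀ (a : Fin d → ℝ) (F : Finset (Fin d → ℤ)) (T : ℝ), 0 < T →
      ((F.filter fun n => 1 + ‖polyPoint f n - a‖ ≤ T).card : ℝ) ≤ C * T ^ s := by
  obtain ⟨C, hC, h⟩ := exists_card_polyPoint_le f hf
  refine ⟨C, hC, fun a F T hT => ?_⟩
  rcases lt_or_ge T 1 with hT1 | hT1
  · rw [Finset.filter_eq_empty_iff.2]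
    · simp only [Finset.card_empty, Nat.cast_zero]
      positivity
    · intro n _ hn
      linarith [norm_nonneg (polyPoint f n - a)]
  · obtain ⟨S, hS, hcard⟩ := h a T hT1
    have hsub : (F.filter fun n => 1 + ‖polyPoint f n - a‖ ≤ T) ⊆ S := by
      intro n hn
      rw [hS]
      linarith [(Finset.mem_filter.1 hn).2]
    calc _ ≤ (S.card : ℝ) := Nat.cast_le.2 (Finset.card_le_card hsub)
      _ ≤ _ := hcard
      _ ≤ _ := by gcongr

theorem sum_smul_polyImage {d : ℕ} (f : Fin d → Polynomial ℝ) (c : Fin d → ℝ) :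
    ∑ i, c i • polyImage (f i) = range fun n : Fin d → ℤ => ∑ i, c i * polyPoint f n i := by
  ext a
  rw [Set.mem_fintype_sum]
  constructor
  · rintro ⟨g, hg, rfl⟩
    have : ∀ i, ∃ m : ℤ, c i * (f i).eval (m : ℝ) = g i := by
      intro i
      obtain ⟨_, ⟨m, rfl⟩, hm⟩ := hg i
      exact ⟨m, hm⟩
    choose n hn using this
    exact ⟨n, Finset.sum_congr rfl fun i _ => hn i⟩
  · rintro ⟨n, rfl⟩
    exact ⟨_, fun i => ⟨_, ⟨n i, rfl⟩, rfl⟩, rfl⟩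

/-! ### General properties of mass measure and mass dimension -/

theorem encard_floorSet_range_le {ι : Type*} (g : ι → ℝ) (ℓ : ℝ) :
    (floorSet (range g) ∩ Ico (-ℓ) ℓ).encard ≤ {n | |g n| ≤ ℓ + 1}.encard := by
  refine le_trans (encard_le_encard ?_) (encard_image_le (fun n => (⌊g n⌋ : ℝ)) _)
  rintro _ ⟨⟨_, ⟨n, rfl⟩, rfl⟩, h1, h2⟩
  refine ⟨n, ?_, rfl⟩
  have h3 := Int.floor_le (g n)
  have h4 := Int.lt_floor_add_one (g n)
  simp only at h1 h2
  rw [mem_ofPred_eq, abs_le]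
  constructor <;> linarith

theorem div_ofReal_rpow (x : ℝ≥0∞) {y : ℝ} (hy : 0 < y) (β : ℝ) :
    x / ENNReal.ofReal (y ^ β) = x * ENNReal.ofReal (y ^ (-β)) := by
  rw [div_eq_mul_inv, Real.rpow_neg hy.le, ENNReal.ofReal_inv_of_pos (by positivity)]

theorem massMeasure_eq_zero_of_lt {A : Set ℝ} {α β : ℝ} (h : massMeasure α A < ⊤) (hαβ : α < β) :
    massMeasure β A = 0 := by
  obtain ⟨M, hM, hMtop⟩ := exists_between h
  have hev := eventually_lt_of_limsup_lt hM
  refine Tendsto.limsup_eq ?_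
  have hlim : Tendsto (fun ℓ : ℝ => M * ENNReal.ofReal ((2 * ℓ) ^ (-(β - α)))) atTop (nhds 0) := by
    have h1 : Tendsto (fun ℓ : ℝ => (2 * ℓ) ^ (-(β - α))) atTop (nhds 0) :=
      (tendsto_rpow_neg_atTop (by linarith)).comp (tendsto_id.const_mul_atTop (by norm_num))
    have h2 := ENNReal.Tendsto.const_mul (a := M) (ENNReal.tendsto_ofReal h1) (Or.inr hMtop.ne)
    simpa using h2
  refine tendsto_of_tendsto_of_tendsto_of_le_of_le' tendsto_const_nhds hlim
    (Eventually.of_forall fun _ => zero_le) ?_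
  filter_upwards [hev, eventually_gt_atTop 0] with ℓ hℓ hpos
  have h2 : 0 < 2 * ℓ := by linarith
  rw [div_ofReal_rpow _ h2] at hℓ ⊢
  have h3 : (2 * ℓ) ^ (-β) = (2 * ℓ) ^ (-α) * (2 * ℓ) ^ (-(β - α)) := by
    rw [← Real.rpow_add h2]; congr 1; ring
  rw [h3, ENNReal.ofReal_mul (by positivity), ← mul_assoc]
  gcongr

theorem massMeasure_one_lt_top (A : Set ℝ) : massMeasure 1 A < ⊤ := by
  refine lt_of_le_of_lt (limsup_le_of_le (a := ENNReal.ofReal 5) (by isBoundedDefault) ?_)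
    ENNReal.ofReal_lt_top
  filter_upwards [eventually_ge_atTop 1] with ℓ hℓ
  rw [Real.rpow_one]
  refine ENNReal.div_le_of_le_mul ?_
  rw [← ENNReal.ofReal_mul (by norm_num)]
  set N := ⌈ℓ⌉₊
  have hN1 : ℓ ≤ N := Nat.le_ceil ℓ
  have hN2 : (N : ℝ) < ℓ + 1 := Nat.ceil_lt_add_one (by linarith)
  have hsub : floorSet A ∩ Ico (-ℓ) ℓ ⊆
      (((Finset.Icc (-(N : ℤ)) N).image fun z : ℤ => (z : ℝ) : Finset ℝ) : Set ℝ) := by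
    rintro _ ⟨⟨a, _, rfl⟩, h1, h2⟩
    simp only at h1 h2
    refine Finset.mem_coe.2 (Finset.mem_image.2 ⟨⌊a⌋, Finset.mem_Icc.2 ⟨?_, ?_⟩, rfl⟩)
    · have : ((-(N : ℤ) : ℤ) : ℝ) ≤ (⌊a⌋ : ℝ) := by push_cast; linarith
      exact_mod_cast this
    · have : (⌊a⌋ : ℝ) ≤ ((N : ℤ) : ℝ) := by push_cast; linarith
      exact_mod_cast this
  have hc : (floorSet A ∩ Ico (-ℓ) ℓ).encard ≤ ((2 * N + 1 : ℕ) : ℕ∞) := by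
    refine (encard_le_encard hsub).trans ?_
    rw [encard_coe_eq_coe_finsetCard]
    refine Nat.cast_le.2 (Finset.card_image_le.trans ?_)
    rw [Int.card_Icc]
    omega
  calc ((floorSet A ∩ Ico (-ℓ) ℓ).encard : ℝ≥0∞) ≤ (((2 * N + 1 : ℕ) : ℕ∞) : ℝ≥0∞) := by
        exact_mod_cast hc
    _ = ENNReal.ofReal ((2 * N + 1 : ℕ) : ℝ) := by
        rw [ENNReal.ofReal_natCast]; simp
    _ ≤ _ := ENNReal.ofReal_le_ofReal (by push_cast; linarith)

theorem massDim_le {A : Set ℝ} {σ : ℝ} (hσ : 0 ≤ σ) (h : ∀ β, σ < β → massMeasure β A = 0) :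
    massDim A ≤ σ := by
  refine le_of_forall_pos_le_add fun ε hε => ?_
  exact csInf_le ⟨0, fun _ hx => hx.1⟩ ⟨by linarith, h _ (by linarith)⟩

theorem le_massDim {A : Set ℝ} {σ : ℝ} (h : 0 < massMeasure σ A) : σ ≤ massDim A := by
  -- The exponent 2 witnesses nonemptiness; the real `sInf` of the empty set would be 0.
  refine le_csInf ⟨2, by norm_num, massMeasure_eq_zero_of_lt (massMeasure_one_lt_top A) (by norm_num)⟩ ?_
  rintro α ⟨_, hα⟩
  by_contra! hlt
  rw [massMeasure_eq_zero_of_lt (by simp [hα]) hlt] at h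
  exact lt_irrefl _ h

/-! ### Upper bound: first moment -/

/-- The number of `n` with `|c · Φ(n)| ≤ t`, where `Φ(n) = (f_i(n_i))_i`. -/
noncomputable def formCount {d : ℕ} (f : Fin d → Polynomial ℝ) (t : ℝ) (c : Fin d → ℝ) : ℝ≥0∞ :=
  ∑' n : Fin d → ℤ, {c : Fin d → ℝ | |∑ i, c i * polyPoint f n i| ≤ t}.indicator 1 c

theorem measurableSet_slab {d : ℕ} (v : Fin d → ℝ) (t : ℝ) :
    MeasurableSet {c : Fin d → ℝ | |∑ i, c i * v i| ≤ t} := by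
  refine measurableSet_le ?_ measurable_const
  fun_prop

theorem measurable_formCount {d : ℕ} (f : Fin d → Polynomial ℝ) (t : ℝ) :
    Measurable (formCount f t) :=
  Measurable.tsum fun _ => measurable_one.indicator (measurableSet_slab _ _)

theorem formCount_mono {d : ℕ} (f : Fin d → Polynomial ℝ) (c : Fin d → ℝ) :
    Monotone fun t => formCount f t c := by
  intro t u htu
  refine ENNReal.tsum_le_tsum fun n => ?_
  exact indicator_le_indicator_of_subset (fun x (hx : _ ≤ t) => le_trans hx htu) (fun _ => zero_le) c

theorem encard_eq_formCount {d : ℕ} (f : Fin d → Polynomial ℝ) (t : ℝ) (c : Fin d → ℝ) :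
    (({n : Fin d → ℤ | |∑ i, c i * polyPoint f n i| ≤ t}.encard : ℕ∞) : ℝ≥0∞) =
      formCount f t c := by
  rw [← ENNReal.tsum_set_one,
    tsum_subtype {n : Fin d → ℤ | |∑ i, c i * polyPoint f n i| ≤ t} fun _ => (1 : ℝ≥0∞), formCount]
  refine tsum_congr fun n => ?_
  simp [indicator]

theorem exists_lintegral_formCount_le {d : ℕ} (f : Fin d → Polynomial ℝ)
    (hf : ∀ i, 0 < (f i).natDegree) (hs : ∑ i, 1 / ((f i).natDegree : ℝ) < 1) (R : ℝ) :
    ∃ K : ℝ≥0∞, K ≠ ⊤ ∧ ∀ t : ℝ, 1 ≤ t → ∫⁻ c, formCount f t c ∂cubeMeasure d R ≤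
      K * ENNReal.ofReal (t ^ ∑ i, 1 / ((f i).natDegree : ℝ)) := by
  set s := ∑ i, 1 / ((f i).natDegree : ℝ)
  obtain ⟨K, hK, hslab⟩ := exists_cubeMeasure_slab_le d R
  obtain ⟨C, hC, hcard⟩ := exists_card_one_add_le f hf (le_refl s)
  refine ⟨K * ENNReal.ofReal (2 * (2 * C * (1 - 2 ^ (s - 1))⁻¹)), by finiteness, fun t ht => ?_⟩
  have hpos : 0 ≤ (1 - (2 : ℝ) ^ (s - 1))⁻¹ := by
    have := Real.rpow_lt_one_of_one_lt_of_neg (x := 2) (z := s - 1) (by norm_num) (by linarith)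
    exact inv_nonneg.2 (by linarith)
  have hsum : ∑' n : Fin d → ℤ, ENNReal.ofReal (t / (t + ‖polyPoint f n‖)) ≤
      ENNReal.ofReal (2 * (2 * C * t ^ s * (1 - 2 ^ (s - 1))⁻¹)) := by
    rw [ENNReal.tsum_eq_iSup_sum]
    refine iSup_le fun F => ?_
    have h := sum_div_add_le (t := t) hs hC.le (by linarith) F (fun n => 1 + ‖polyPoint f n - 0‖)
      (fun n _ => by positivity) (hcard 0 F)
    rw [ENNReal.ofReal_mul (by norm_num)]
    refine le_trans ?_ (mul_le_mul_right h _)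
    rw [Finset.mul_sum]
    refine Finset.sum_le_sum fun n _ => ?_
    rw [← ENNReal.ofReal_mul (by norm_num)]
    refine ENNReal.ofReal_le_ofReal ?_
    have hn := norm_nonneg (polyPoint f n)
    rw [sub_zero, ← mul_div_assoc, div_le_div_iff₀ (by linarith) (by linarith)]
    nlinarith
  calc ∫⁻ c, formCount f t c ∂cubeMeasure d R
      = ∑' n, cubeMeasure d R {c | |∑ i, c i * polyPoint f n i| ≤ t} := by
        simp only [formCount]
        rw [lintegral_tsum fun n => (measurable_one.indicator (measurableSet_slab _ _)).aemeasurable]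
        exact tsum_congr fun n => lintegral_indicator_one (measurableSet_slab _ _)
    _ ≤ ∑' n, K * ENNReal.ofReal (t / (t + ‖polyPoint f n‖)) :=
        ENNReal.tsum_le_tsum fun n => hslab _ t (by linarith)
    _ ≤ K * ENNReal.ofReal (2 * (2 * C * t ^ s * (1 - 2 ^ (s - 1))⁻¹)) := by
        rw [ENNReal.tsum_mul_left]
        gcongr
    _ = _ := by
        rw [mul_assoc K, ← ENNReal.ofReal_mul (by positivity)]
        congr 2; ring

theorem ae_massMeasure_lt_top {d : ℕ} (f : Fin d → Polynomial ℝ)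
    (hf : ∀ i, 0 < (f i).natDegree) (hs : ∑ i, 1 / ((f i).natDegree : ℝ) < 1) {β : ℝ}
    (hβ : ∑ i, 1 / ((f i).natDegree : ℝ) < β) :
    ∀ᵐ c : Fin d → ℝ ∂volume, massMeasure β (∑ i, c i • polyImage (f i)) < ⊤ := by
  refine ae_of_forall_ae_cubeMeasure fun R => ?_
  obtain ⟨K, hK, hint⟩ := exists_lintegral_formCount_le f hf hs R
  set s := ∑ i, 1 / ((f i).natDegree : ℝ)
  have hs0 : 0 ≤ s := Finset.sum_nonneg fun i _ => by positivity
  -- The mean of the `k`-th term is `O(2^((s-β)k))`, so `W` is integrable and finite almost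
  -- everywhere. Each term is at most `W`, and `formCount` is monotone in `t`, so `W` controls every
  -- real `ℓ ≥ 1` simultaneously.
  set W : (Fin d → ℝ) → ℝ≥0∞ := fun c =>
    ∑' k : ℕ, formCount f (2 ^ k) c * ENNReal.ofReal ((2 ^ k) ^ (-β))
  have hWm : Measurable W :=
    Measurable.tsum fun k => (measurable_formCount f _).mul_const _
  have hW : ∫⁻ c, W c ∂cubeMeasure d R ≠ ⊤ := by
    have h1 : ∫⁻ c, W c ∂cubeMeasure d R ≤
        K * ∑' k : ℕ, ENNReal.ofReal (1 * (2 ^ (s - β)) ^ k) := by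
      rw [lintegral_tsum fun k => ((measurable_formCount f _).mul_const _).aemeasurable,
        ← ENNReal.tsum_mul_left]
      refine ENNReal.tsum_le_tsum fun k => ?_
      rw [lintegral_mul_const _ (measurable_formCount f _)]
      refine (mul_le_mul_left (hint _ (one_le_pow₀ (by norm_num))) _).trans (le_of_eq ?_)
      rw [mul_assoc, ← ENNReal.ofReal_mul (by positivity), ← Real.rpow_add (by positivity),
        ← Real.rpow_natCast_mul (by norm_num), mul_comm (k : ℝ), Real.rpow_mul_natCast (by norm_num),
        one_mul, sub_eq_add_neg]
    refine ne_top_of_le_ne_top ?_ h1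
    rw [tsum_ofReal_mul_geometric (by norm_num) (by positivity)
      (Real.rpow_lt_one_of_one_lt_of_neg (by norm_num) (by linarith))]
    finiteness
  filter_upwards [ae_lt_top hWm hW] with c hc
  rw [sum_smul_polyImage]
  refine lt_of_le_of_lt (limsup_le_of_le (a := ENNReal.ofReal (2 ^ β) * W c)
    (by isBoundedDefault) ?_) (ENNReal.mul_lt_top ENNReal.ofReal_lt_top hc)
  filter_upwards [eventually_ge_atTop 1] with ℓ hℓ
  obtain ⟨k, hk, hk'⟩ := exists_nat_pow_near (x := ℓ + 1) (y := (2 : ℝ)) (by linarith) (by norm_num)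
  rw [div_ofReal_rpow _ (by linarith)]
  have h1 : ((floorSet (range fun n : Fin d → ℤ => ∑ i, c i * polyPoint f n i) ∩
      Ico (-ℓ) ℓ).encard : ℝ≥0∞) ≤ formCount f (2 ^ (k + 1)) c := by
    refine le_trans ?_ (formCount_mono f c hk'.le)
    beta_reduce
    rw [← encard_eq_formCount]
    exact_mod_cast encard_floorSet_range_le _ ℓ
  -- Here `2^k ≤ ℓ + 1 ≤ 2ℓ`, so replacing `2ℓ` by `2^(k+1)` costs a factor of at most `2^β`.
  have h2 : (2 * ℓ) ^ (-β) ≤ 2 ^ β * (2 ^ (k + 1)) ^ (-β) := by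
    have h3 : (2 : ℝ) ^ (k + 1) / 2 ≤ 2 * ℓ := by rw [pow_succ]; linarith
    refine (Real.rpow_le_rpow_of_nonpos (by positivity) h3 (by linarith)).trans (le_of_eq ?_)
    rw [Real.div_rpow (by positivity) (by norm_num), Real.rpow_neg (by norm_num : (0 : ℝ) ≤ 2)]
    field_simp
  calc _ ≤ formCount f (2 ^ (k + 1)) c * ENNReal.ofReal (2 ^ β * (2 ^ (k + 1)) ^ (-β)) :=
        mul_le_mul' h1 (ENNReal.ofReal_le_ofReal h2)
    _ = ENNReal.ofReal (2 ^ β) *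
        (formCount f (2 ^ (k + 1)) c * ENNReal.ofReal ((2 ^ (k + 1)) ^ (-β))) := by
        rw [ENNReal.ofReal_mul (by positivity)]; ring
    _ ≤ _ := by
        gcongr
        exact ENNReal.le_tsum (f := fun k : ℕ =>
          formCount f (2 ^ k) c * ENNReal.ofReal ((2 ^ k) ^ (-β))) (k + 1)

theorem ae_massDim_le {d : ℕ} (f : Fin d → Polynomial ℝ) (hf : ∀ i, 0 < (f i).natDegree) :
    ∀ᵐ c : Fin d → ℝ ∂volume,
      massDim (∑ i, c i • polyImage (f i)) ≤ min 1 (∑ i, 1 / ((f i).natDegree : ℝ)) := by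
  have hs0 : 0 ≤ ∑ i, 1 / ((f i).natDegree : ℝ) := Finset.sum_nonneg fun i _ => by positivity
  rcases le_or_gt 1 (∑ i, 1 / ((f i).natDegree : ℝ)) with hs | hs
  · rw [min_eq_left hs]
    exact Eventually.of_forall fun c => massDim_le zero_le_one fun β hβ =>
      massMeasure_eq_zero_of_lt (massMeasure_one_lt_top _) hβ
  · rw [min_eq_right hs.le]
    obtain ⟨u, -, hu, hlim⟩ := exists_seq_strictAnti_tendsto (∑ i, 1 / ((f i).natDegree : ℝ))
    filter_upwards [ae_all_iff.2 fun k => ae_massMeasure_lt_top f hf hs (hu k)] with c hc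
    refine massDim_le hs0 fun β hβ => ?_
    obtain ⟨k, hk⟩ := (hlim.eventually_lt_const hβ).exists
    exact massMeasure_eq_zero_of_lt (hc k) hk

/-! ### Lower bound: second moment -/

/-- Discrete energy estimate, uniform in the centre `a`, later taken to be another `Φ(n)`. The sum
stays bounded for `s < 1` and is of order `T^(s-1)` for `s > 1`; at `s = 1` the dyadic scales
contribute equally and produce a logarithm. -/
theorem exists_sum_one_div_le {d : ℕ} (f : Fin d → Polynomial ℝ)
    (hf : ∀ i, 0 < (f i).natDegree) {s : ℝ} (hs : ∑ i, 1 / ((f i).natDegree : ℝ) ≤ s)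
    (hs1 : s ≠ 1) :
    ∃ C : ℝ, 0 ≤ C ∧ ∀ (a : Fin d → ℝ) (T : ℝ) (F : Finset (Fin d → ℤ)), 1 ≤ T →
      (∀ n ∈ F, ‖polyPoint f n - a‖ ≤ 2 * T) →
        ∑ n ∈ F, ENNReal.ofReal (1 / (1 + ‖polyPoint f n - a‖)) ≤
          ENNReal.ofReal (C * T ^ max 0 (s - 1)) := by
  obtain ⟨C, hC, hcard⟩ := exists_card_one_add_le f hf hs
  rcases lt_or_gt_of_ne hs1 with h1 | h1
  · have hpos : 0 ≤ (1 - (2 : ℝ) ^ (s - 1))⁻¹ := by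
      have := Real.rpow_lt_one_of_one_lt_of_neg (x := 2) (z := s - 1) (by norm_num) (by linarith)
      exact inv_nonneg.2 (by linarith)
    refine ⟨2 * (2 * C * (1 - 2 ^ (s - 1))⁻¹), by positivity, fun a T F _ _ => ?_⟩
    have h := sum_div_add_le (t := 1) h1 hC.le one_pos F (fun n => 1 + ‖polyPoint f n - a‖)
      (fun n _ => by positivity) (hcard a F)
    rw [Real.one_rpow, mul_one] at h
    rw [max_eq_left (by linarith), Real.rpow_zero, mul_one, ENNReal.ofReal_mul (by norm_num)]
    refine le_trans ?_ (mul_le_mul_right h _)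
    rw [Finset.mul_sum]
    refine Finset.sum_le_sum fun n _ => ?_
    rw [← ENNReal.ofReal_mul (by norm_num)]
    refine ENNReal.ofReal_le_ofReal ?_
    have hn := norm_nonneg (polyPoint f n - a)
    rw [← mul_div_assoc, div_le_div_iff₀ (by linarith) (by linarith)]
    linarith
  · have hpos : 0 ≤ (1 - (2 : ℝ) ^ (1 - s))⁻¹ := by
      have := Real.rpow_lt_one_of_one_lt_of_neg (x := 2) (z := 1 - s) (by norm_num) (by linarith)
      exact inv_nonneg.2 (by linarith)
    refine ⟨2 * C * 3 ^ (s - 1) * (1 - 2 ^ (1 - s))⁻¹, by positivity, fun a T F hT hF => ?_⟩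
    refine (sum_one_div_le (L := 3 * T) h1 hC.le (by linarith) F (fun n => 1 + ‖polyPoint f n - a‖)
      (fun n _ => by positivity) (fun n hn => by linarith [hF n hn]) (hcard a F)).trans (le_of_eq ?_)
    rw [max_eq_right (by linarith), Real.mul_rpow (by norm_num) (by linarith)]
    congr 1; ring

/-- Cauchy-Schwarz over the fibres of `⌊g⌋`: points in one fibre are within 1 of each other, so the
squared fibre sizes sum to at most the number of close pairs. -/
theorem sq_card_le_card_image_floor_mul {ι : Type*} (S : Finset ι) (g : ι → ℝ) :
    S.card ^ 2 ≤ (S.image fun n => ⌊g n⌋).card *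
      ∑ n ∈ S, (S.filter fun m => |g n - g m| ≤ 1).card := by
  classical
  have h1 := Finset.card_eq_sum_card_image (fun n => ⌊g n⌋) S
  rw [h1]
  refine sq_sum_le_card_mul_sum_sq.trans (Nat.mul_le_mul_left _ ?_)
  rw [← Finset.sum_fiberwise_of_maps_to (g := fun n => ⌊g n⌋) (t := S.image fun n => ⌊g n⌋)
    fun n hn => Finset.mem_image_of_mem _ hn]
  refine Finset.sum_le_sum fun z _ => ?_
  rw [sq, ← smul_eq_mul]
  refine Finset.card_nsmul_le_sum _ _ _ fun n hn => Finset.card_le_card fun m hm => ?_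
  rw [Finset.mem_filter] at hn hm ⊢
  exact ⟨hm.1, (Int.abs_sub_lt_one_of_floor_eq_floor (hn.2.trans hm.2.symm)).le⟩

/-- The number of pairs in `S` at which the linear form `c` takes values at distance at most `1`. -/
noncomputable def pairCount {d : ℕ} (f : Fin d → Polynomial ℝ) (S : Finset (Fin d → ℤ))
    (c : Fin d → ℝ) : ℝ≥0∞ :=
  ∑ n ∈ S, ∑ m ∈ S,
    {c : Fin d → ℝ | |∑ i, c i * (polyPoint f m - polyPoint f n) i| ≤ 1}.indicator 1 c

theorem measurable_pairCount {d : ℕ} (f : Fin d → Polynomial ℝ) (S : Finset (Fin d → ℤ)) :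
    Measurable (pairCount f S) :=
  Finset.measurable_fun_sum _ fun _ _ => Finset.measurable_fun_sum _ fun _ _ =>
    measurable_one.indicator (measurableSet_slab _ _)

theorem sq_card_le_mul_pairCount {d : ℕ} (f : Fin d → Polynomial ℝ) (S : Finset (Fin d → ℤ))
    (c : Fin d → ℝ) :
    (S.card : ℝ≥0∞) ^ 2 ≤
      ((S.image fun n => ⌊∑ i, c i * polyPoint f n i⌋).card : ℝ≥0∞) * pairCount f S c := by
  have h := sq_card_le_card_image_floor_mul S fun n => ∑ i, c i * polyPoint f n i
  have h' : ((S.card ^ 2 : ℕ) : ℝ≥0∞) ≤ _ := Nat.cast_le.2 h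
  push_cast at h'
  refine h'.trans (le_of_eq ?_)
  congr 1
  refine Finset.sum_congr rfl fun n _ => ?_
  rw [Finset.card_filter]
  push_cast
  refine Finset.sum_congr rfl fun m _ => ?_
  rw [indicator, abs_sub_comm]
  simp [mul_sub]

theorem exists_lintegral_pairCount_le {d : ℕ} (f : Fin d → Polynomial ℝ)
    (hf : ∀ i, 0 < (f i).natDegree) {s : ℝ} (hs : ∑ i, 1 / ((f i).natDegree : ℝ) ≤ s)
    (hs1 : s ≠ 1) (R : ℝ) :
    ∃ K : ℝ≥0∞, K ≠ ⊤ ∧ ∀ (T : ℝ) (S : Finset (Fin d → ℤ)), 1 ≤ T →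
      (∀ n ∈ S, ‖polyPoint f n‖ ≤ T) →
        ∫⁻ c, pairCount f S c ∂cubeMeasure d R ≤
          K * ENNReal.ofReal (S.card * T ^ max 0 (s - 1)) := by
  obtain ⟨K, hK, hslab⟩ := exists_cubeMeasure_slab_le d R
  obtain ⟨C, hC, hsum⟩ := exists_sum_one_div_le f hf hs hs1
  refine ⟨K * ENNReal.ofReal C, by finiteness, fun T S hT hS => ?_⟩
  have hmeas : ∀ n m : Fin d → ℤ, Measurable
      ({c : Fin d → ℝ | |∑ i, c i * (polyPoint f m - polyPoint f n) i| ≤ 1}.indicator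
        (1 : (Fin d → ℝ) → ℝ≥0∞)) :=
    fun n m => measurable_one.indicator (measurableSet_slab _ _)
  simp only [pairCount]
  rw [lintegral_finsetSum _ fun n _ => Finset.measurable_fun_sum _ fun m _ => hmeas n m]
  calc _ ≤ ∑ n ∈ S, K * ENNReal.ofReal (C * T ^ max 0 (s - 1)) := by
        refine Finset.sum_le_sum fun n hn => ?_
        rw [lintegral_finsetSum _ fun m _ => hmeas n m]
        refine le_trans ?_ (mul_le_mul_right (hsum (polyPoint f n) T S hT fun m hm => ?_) K)
        · rw [Finset.mul_sum]
          refine Finset.sum_le_sum fun m _ => ?_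
          rw [lintegral_indicator_one (measurableSet_slab _ _)]
          exact hslab _ 1 one_pos
        · refine (norm_sub_le _ _).trans ?_
          linarith [hS n hn, hS m hm]
    _ = _ := by
        rw [Finset.sum_const, nsmul_eq_mul, ENNReal.ofReal_mul hC,
          ENNReal.ofReal_mul (Nat.cast_nonneg _), ENNReal.ofReal_natCast]
        ring

/-- On the cube `|c · Φ(n)| ≤ d R T`. The extra `2T ≥ 2` absorbs the rounding and the open right end
of the window. -/
theorem card_image_floor_le_encard {d : ℕ} (f : Fin d → Polynomial ℝ) {R T : ℝ} (hR : 0 ≤ R)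
    (hT : 1 ≤ T) (S : Finset (Fin d → ℤ)) (hS : ∀ n ∈ S, ‖polyPoint f n‖ ≤ T) (c : Fin d → ℝ)
    (hc : c ∈ Set.pi univ fun _ : Fin d => Icc (-R) R) :
    ((S.image fun n => ⌊∑ i, c i * polyPoint f n i⌋).card : ℕ∞) ≤
      (floorSet (∑ i, c i • polyImage (f i)) ∩ Ico (-((d * R + 2) * T)) ((d * R + 2) * T)).encard := by
  rw [sum_smul_polyImage, ← Finset.card_image_of_injective _ (Int.cast_injective (α := ℝ)),
    ← encard_coe_eq_coe_finsetCard]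
  refine encard_le_encard ?_
  intro x hx
  obtain ⟨_, hz, rfl⟩ := Finset.mem_image.1 (Finset.mem_coe.1 hx)
  obtain ⟨n, hn, rfl⟩ := Finset.mem_image.1 hz
  have habs : |∑ i, c i * polyPoint f n i| ≤ d * R * T := by
    refine (Finset.abs_sum_le_sum_abs _ _).trans ?_
    have : ∀ i ∈ Finset.univ, |c i * polyPoint f n i| ≤ R * T := fun i _ => by
      rw [abs_mul]
      exact mul_le_mul (abs_le.2 (hc i trivial)) ((norm_le_pi_norm (polyPoint f n) i).trans (hS n hn))
        (abs_nonneg _) hR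
    refine (Finset.sum_le_sum this).trans (le_of_eq ?_)
    simp [mul_assoc]
  rw [abs_le] at habs
  refine ⟨⟨_, ⟨n, rfl⟩, rfl⟩, ?_, ?_⟩
  · have := Int.lt_floor_add_one (∑ i, c i * polyPoint f n i)
    linarith
  · have := Int.floor_le (∑ i, c i * polyPoint f n i)
    linarith

/-- The parameter `s` need not equal `σ = ∑ 1/deg f_i`. For `σ ≠ 1`, taking `s = σ` gives the sharp
exponent `min(1, σ)`; for `σ = 1`, any `s > 1` gives a slightly smaller one. -/
theorem ae_massMeasure_pos {d : ℕ} (f : Fin d → Polynomial ℝ) (hf : ∀ i, 0 < (f i).natDegree)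
    {s : ℝ} (hs : ∑ i, 1 / ((f i).natDegree : ℝ) ≤ s) (hs1 : s ≠ 1) :
    ∀ᵐ c : Fin d → ℝ ∂volume,
      0 < massMeasure (∑ i, 1 / ((f i).natDegree : ℝ) - max 0 (s - 1))
        (∑ i, c i • polyImage (f i)) := by
  refine ae_of_forall_ae_cubeMeasure fun R => ?_
  obtain ⟨K, hK, hpair⟩ := exists_lintegral_pairCount_le f hf hs hs1 R
  obtain ⟨C, hC, hbox⟩ := exists_card_polyPoint_le f hf
  obtain ⟨c₀, hc₀, hlow⟩ := exists_le_card_polyPoint f hf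
  set σ := ∑ i, 1 / ((f i).natDegree : ℝ)
  set α := σ - max 0 (s - 1) with hα
  have hbox' : ∀ ℓ : ℕ, ∃ S : Finset (Fin d → ℤ), 1 ≤ ℓ →
      ∀ n, n ∈ S ↔ ‖polyPoint f n‖ ≤ (ℓ : ℝ) := by
    intro ℓ
    by_cases hℓ : 1 ≤ ℓ
    · obtain ⟨S, hS, -⟩ := hbox 0 ℓ (by exact_mod_cast hℓ)
      exact ⟨S, fun _ n => by simpa using hS n⟩
    · exact ⟨∅, fun h => absurd h hℓ⟩
  choose S hS using hbox'
  -- Normalised so that `∫ X ℓ ≤ K ℓ^σ / |S ℓ| ≤ K / c₀` eventually, while `X ℓ c < M` forces at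
  -- least `ℓ^α / M` distinct floors. A bound at infinitely many `ℓ`, which Fatou supplies, is
  -- enough for a limsup.
  set X : ℕ → (Fin d → ℝ) → ℝ≥0∞ := fun ℓ c =>
    pairCount f (S ℓ) c * ENNReal.ofReal ((ℓ : ℝ) ^ α / ((S ℓ).card : ℝ) ^ 2)
  have hXm : ∀ ℓ, Measurable (X ℓ) := fun ℓ => (measurable_pairCount f _).mul_const _
  have hlow' : ∀ᶠ ℓ : ℕ in atTop, c₀ * (ℓ : ℝ) ^ σ ≤ ((S ℓ).card : ℝ) := by
    filter_upwards [tendsto_natCast_atTop_atTop.eventually hlow, eventually_ge_atTop 1] with ℓ h hℓ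
    exact h (S ℓ) fun n hn => (hS ℓ hℓ n).2 hn
  have hXint : ∀ᶠ ℓ : ℕ in atTop,
      ∫⁻ c, X ℓ c ∂cubeMeasure d R ≤ K * ENNReal.ofReal (1 / c₀) := by
    filter_upwards [hlow', eventually_ge_atTop 1] with ℓ hℓ hℓ1
    have hℓpos : (0 : ℝ) < ℓ := by exact_mod_cast hℓ1
    have hN : 0 < ((S ℓ).card : ℝ) := lt_of_lt_of_le (by positivity) hℓ
    rw [lintegral_mul_const _ (measurable_pairCount f _)]
    refine (mul_le_mul_left (hpair ℓ (S ℓ) (by exact_mod_cast hℓ1)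
      fun n hn => (hS ℓ hℓ1 n).1 hn) _).trans ?_
    rw [mul_assoc, ← ENNReal.ofReal_mul (by positivity)]
    refine mul_le_mul_right (ENNReal.ofReal_le_ofReal ?_) K
    have h1 : (ℓ : ℝ) ^ max 0 (s - 1) * (ℓ : ℝ) ^ α = (ℓ : ℝ) ^ σ := by
      rw [← Real.rpow_add hℓpos, hα]; congr 1; ring
    calc _ = (ℓ : ℝ) ^ σ / (S ℓ).card := by
          rw [← h1]; field_simp
      _ ≤ _ := by
          rw [div_le_div_iff₀ hN hc₀]; linarith
  have hfatou : ∫⁻ c, liminf (fun ℓ => X ℓ c) atTop ∂cubeMeasure d R ≠ ⊤ := by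
    refine ne_top_of_le_ne_top ?_ ((lintegral_liminf_le hXm).trans
      (liminf_le_of_frequently_le' hXint.frequently))
    finiteness
  filter_upwards [ae_lt_top (Measurable.liminf hXm) hfatou,
    ae_restrict_mem (MeasurableSet.univ_pi fun _ => measurableSet_Icc)] with c hc hcR
  obtain ⟨M, hM, hMtop⟩ := exists_between hc
  have hfreq := frequently_lt_of_liminf_lt (by isBoundedDefault) hM
  set Q : ℝ := d * R + 2
  have hQ : 0 < Q := by positivity
  -- The window is `[-Qℓ, Qℓ)`, so the normaliser is `(2Qℓ)^α` rather than `ℓ^α`; the ratio is then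
  -- at least `1 / B`.
  set B : ℝ≥0∞ := M * ENNReal.ofReal ((2 * Q) ^ α)
  have hB : B ≠ ⊤ := by finiteness
  refine lt_of_lt_of_le (ENNReal.div_pos one_ne_zero hB) (le_limsup_of_frequently_le ?_)
  have htend : Tendsto (fun ℓ : ℕ => Q * (ℓ : ℝ)) atTop atTop :=
    tendsto_natCast_atTop_atTop.const_mul_atTop hQ
  refine htend.frequently ?_
  refine (hfreq.and_eventually (hlow'.and (eventually_ge_atTop 1))).mono ?_
  rintro ℓ ⟨hX, hℓ, hℓ1⟩
  have hℓpos : (0 : ℝ) < ℓ := by exact_mod_cast hℓ1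
  have hN : 0 < ((S ℓ).card : ℝ) := lt_of_lt_of_le (by positivity) hℓ
  refine ENNReal.div_le_of_le_mul ?_
  rw [div_ofReal_rpow _ (by positivity)]
  have hD := card_image_floor_le_encard f (Nat.cast_nonneg R) (by exact_mod_cast hℓ1 : (1 : ℝ) ≤ ℓ)
    (S ℓ) (fun n hn => (hS ℓ hℓ1 n).1 hn) c hcR
  set D := (floorSet (∑ i, c i • polyImage (f i)) ∩ Ico (-(Q * ℓ)) (Q * ℓ)).encard
  have hD' : (((S ℓ).image fun n => ⌊∑ i, c i * polyPoint f n i⌋).card : ℝ≥0∞) ≤ (D : ℝ≥0∞) := by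
    exact_mod_cast ENat.toENNReal_le.2 hD
  have hCS := (sq_card_le_mul_pairCount f (S ℓ) c).trans (mul_le_mul_left hD' _)
  have h1 : ENNReal.ofReal ((2 * (Q * ℓ)) ^ (-α)) * ENNReal.ofReal ((2 * Q) ^ α) =
      ENNReal.ofReal ((ℓ : ℝ) ^ (-α)) := by
    rw [← ENNReal.ofReal_mul (by positivity), ← mul_assoc, Real.mul_rpow (by positivity) hℓpos.le,
      Real.rpow_neg (by positivity : 0 ≤ 2 * Q)]
    congr 1
    field_simp
  calc (1 : ℝ≥0∞) = ((S ℓ).card : ℝ≥0∞) ^ 2 * ENNReal.ofReal ((ℓ : ℝ) ^ α / ((S ℓ).card : ℝ) ^ 2) *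
        ENNReal.ofReal ((ℓ : ℝ) ^ (-α)) := by
        rw [← ENNReal.ofReal_natCast, ← ENNReal.ofReal_pow (by positivity),
          ← ENNReal.ofReal_mul (by positivity), ← ENNReal.ofReal_mul (by positivity),
          Real.rpow_neg hℓpos.le, ← ENNReal.ofReal_one]
        congr 1
        field_simp
    _ ≤ D * pairCount f (S ℓ) c * ENNReal.ofReal ((ℓ : ℝ) ^ α / ((S ℓ).card : ℝ) ^ 2) *
        ENNReal.ofReal ((ℓ : ℝ) ^ (-α)) := by gcongr
    _ ≤ D * M * ENNReal.ofReal ((ℓ : ℝ) ^ (-α)) := by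
        rw [mul_assoc (D : ℝ≥0∞)]
        gcongr
    _ = _ := by rw [← h1]; ring

theorem ae_le_massDim {d : ℕ} (f : Fin d → Polynomial ℝ) (hf : ∀ i, 0 < (f i).natDegree) :
    ∀ᵐ c : Fin d → ℝ ∂volume,
      min 1 (∑ i, 1 / ((f i).natDegree : ℝ)) ≤ massDim (∑ i, c i • polyImage (f i)) := by
  set σ := ∑ i, 1 / ((f i).natDegree : ℝ) with hσ
  -- Every `u k` exceeds both `σ` and 1, so the excluded value 1 is avoided even when `σ = 1`. The
  -- exponents `σ - (u k - 1)` tend to `σ + 1 - max(σ, 1) = min(1, σ)`, and a sequence keeps the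
  -- exceptional sets countable in number.
  obtain ⟨u, -, hu, hlim⟩ := exists_seq_strictAnti_tendsto (max σ 1)
  have hu' : ∀ k, σ < u k ∧ 1 < u k := fun k => max_lt_iff.1 (hu k)
  filter_upwards [ae_all_iff.2 fun k => ae_massMeasure_pos f hf (hu' k).1.le (hu' k).2.ne'] with c hc
  have hlim' : Tendsto (fun k => σ - max 0 (u k - 1)) atTop (nhds (min 1 σ)) := by
    have h := tendsto_const_nhds.sub ((tendsto_const_nhds (x := (0 : ℝ))).max (hlim.sub_const 1))
      (a := σ)
    convert h using 2
    rcases le_total σ 1 with h1 | h1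
    · simp [h1]
    · simp [h1]
  exact le_of_tendsto' hlim' fun k => le_massDim (hc k)

theorem corollaryF (d : ℕ) (f : Fin d → Polynomial ℝ) (hf : ∀ i, 0 < (f i).natDegree) :
    (∀ᵐ c : Fin d → ℝ ∂volume,
      massDim (∑ i, c i • polyImage (f i)) = min 1 (∑ i, 1 / ((f i).natDegree : ℝ))) ∧
    ((∑ i, 1 / ((f i).natDegree : ℝ)) ≠ 1 →
      ∀ᵐ c : Fin d → ℝ ∂volume,
        0 < massMeasure (min 1 (∑ i, 1 / ((f i).natDegree : ℝ)))
          (∑ i, c i • polyImage (f i))) := by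
  refine ⟨?_, fun hs => ?_⟩
  · filter_upwards [ae_massDim_le f hf, ae_le_massDim f hf] with c h1 h2
    exact le_antisymm h1 h2
  · have h := ae_massMeasure_pos f hf le_rfl hs
    have hmin : ∀ x : ℝ, x - max 0 (x - 1) = min 1 x := by
      intro x
      rcases le_total x 1 with h1 | h1 <;> simp [h1]
    rwa [hmin] at h
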